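/- For a bounded set $K\subset\mathbb{R}^d$, $d\ge 2$, a point $x\in K$ and $r>0$ put $$\beta_K(x,r)=\inf_L\ \sup_{z\in K\cap B(x,r)}\frac{\operatorname{dist}(z,L)}{r},$$ where the infimum is over all lines $L$ in $\mathbb{R}^d$ and $B(x,r)$ is the open ball. For $\lambda,\kappa,\beta_0\in(0,1)$, the set $K$ is called almost flat at $x\in K$ with parameters $\lambda,\kappa,\beta_0$ if there is a sequence of positive integers $N_i\to\infty$ such that, for every $i$, the number of integers $m$ with $0\le m<N_i$ and $\beta_K(x,\lambda^m)\le\beta_0$ is greater than $\kappa N_i$. Theorem. For every $d\ge 2$ there is a constant $c'>0$, depending only on $d$, such that the following holds. Let $\lambda,\kappa,\beta_0\in(0,1)$ and let $K\subset\mathbb{R}^d$ be a set of diameter $1$ that is almost flat at every point $x\in K$ with the same parameters $\lambda,\kappa,\beta_0$. Then $$\dim_H K\le 1+c'\lambda^{-4}\left(1-\kappa+\beta_0^2\,\kappa\right).$$ -/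

import Mathlib

/-- The beta number `β_K(x, r) = inf_L sup_{z ∈ K ∩ B(x, r)} dist(z, L) / r` of a subset `K` of
`ℝ^d`, the infimum being over all lines `L`, that is, over all one-dimensional affine subspaces.
It takes values in `[0, ∞]`, so that neither the infimum nor the supremum needs a convention. -/
noncomputable def betaNumber {d : ℕ} (K : Set (EuclideanSpace ℝ (Fin d)))
    (x : EuclideanSpace ℝ (Fin d)) (r : ℝ) : ENNReal :=
  ⨅ L : {L : AffineSubspace ℝ (EuclideanSpace ℝ (Fin d)) // Module.finrank ℝ L.direction = 1},
    ⨆ z ∈ K ∩ Metric.ball x r,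
      Metric.infEDist z (L.1 : Set (EuclideanSpace ℝ (Fin d))) / ENNReal.ofReal r

/-- `K` is almost flat at `x` with parameters `lam`, `kap`, `beta0`: there are positive integers
`N i` tending to infinity such that, for every `i`, more than `kap * N i` of the scales `lam ^ m`
with `0 ≤ m < N i` are flat, where the scale `r` is flat if `β_K(x, r) ≤ beta0`. -/
def AlmostFlatAt {d : ℕ} (K : Set (EuclideanSpace ℝ (Fin d)))
    (x : EuclideanSpace ℝ (Fin d)) (lam kap beta0 : ℝ) : Prop :=
  ∃ N : ℕ → ℕ, (∀ i, 0 < N i) ∧ Filter.Tendsto N Filter.atTop Filter.atTop ∧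
    ∀ i, kap * (N i : ℝ) <
      (Set.ncard {m : ℕ | m < N i ∧ betaNumber K x (lam ^ m) ≤ ENNReal.ofReal beta0} : ℝ)

open MeasureTheory Filter Topology

/-! Cover `K` by successive generations, the `k`-th made of sets of diameter at most `s ^ k`, where
`s ^ 2 = 1 / 4 + 64 * (beta0 / lam) ^ 2`, so `s` is slightly above `1 / 2`. If such a set contains a
point with a flat scale `lam ^ m` in `(s ^ k, 2 / lam * s ^ k]`, it lies in a thin strip, and
cutting the strip across its middle gives two sets of the next generation
(`exists_two_pieces_of_strip`). Otherwise generation `k` is bad for all its points, and it is cut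
into `M` pieces, `M` depending only on `d`.

Passing on mass equally makes a set with `b` bad ancestors weigh `2 ^ (-T) * (2 / M) ^ b`, with
total at most `1`. Comparing lengths on a logarithmic axis shows that each point has, for infinitely
many `T`, at most `1 + (1 - kap) * T` bad generations (`frequently_card_le_of_almostFlatAt`). So
only sets with few bad ancestors are needed. There are at most `2 ^ T * (M / 2) ^ (1 + (1 - kap) *
T)` of them, and their `α`-sums are dominated by a geometric series of ratio `q = s ^ α * 2 * (M /
2) ^ (1 - kap)`. The constant `c` is chosen to make `q < 1`. -/

/-! ### Cutting a set into smaller pieces -/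

/-- A set in which any two points are at distance at most `D` and which lies within `w` of a line
is the union of two sets with diameter at most `√((D / 2) ^ 2 + (2 * w) ^ 2)`. -/
theorem exists_two_pieces_of_strip {E : Type*} [NormedAddCommGroup E] [InnerProductSpace ℝ E]
    {S : Set E} {D D' w : ℝ} {p u : E} (hu : ‖u‖ = 1) (hD' : 0 ≤ D')
    (hDD' : (D / 2) ^ 2 + (2 * w) ^ 2 ≤ D' ^ 2)
    (hS : ∀ z ∈ S, ∃ τ : ℝ, dist z (p + τ • u) ≤ w)
    (hD : ∀ z ∈ S, ∀ z' ∈ S, dist z z' ≤ D) :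
    ∃ P : Fin 2 → Set E, (∀ i, P i ⊆ S) ∧ S ⊆ ⋃ i, P i ∧
      ∀ i, ∀ z ∈ P i, ∀ z' ∈ P i, dist z z' ≤ D' := by
  rcases S.eq_empty_or_nonempty with rfl | ⟨z₀, hz₀⟩
  · exact ⟨fun _ => ∅, by simp, by simp, by simp⟩
  have hdiff : ∀ z ∈ S, ∀ z' ∈ S, inner ℝ z u - inner ℝ z' u ≤ D := by
    intro z hz z' hz'
    rw [← inner_sub_left]
    calc inner ℝ (z - z') u ≤ ‖z - z'‖ * ‖u‖ := real_inner_le_norm _ _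
      _ ≤ D := by rw [hu, mul_one, ← dist_eq_norm]; exact hD z hz z' hz'
  -- The coordinate along `u` ranges in `[a, a + D]` on `S`; the cut is at its midpoint.
  obtain ⟨a, ha⟩ : ∃ a, a = sInf ((fun z => inner ℝ z u) '' S) := ⟨_, rfl⟩
  have hbdd : BddBelow ((fun z => inner ℝ z u) '' S) := by
    refine ⟨inner ℝ z₀ u - D, ?_⟩
    rintro _ ⟨z, hz, rfl⟩
    have := hdiff z₀ hz₀ z hz
    simp only
    linarith
  have hlo : ∀ z ∈ S, a ≤ inner ℝ z u := fun z hz => ha ▸ csInf_le hbdd ⟨z, hz, rfl⟩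
  have hhi : ∀ z ∈ S, inner ℝ z u ≤ a + D := by
    intro z hz
    have : inner ℝ z u - D ≤ a := by
      rw [ha]
      refine le_csInf ⟨_, z₀, hz₀, rfl⟩ ?_
      rintro _ ⟨z', hz', rfl⟩
      have := hdiff z hz z' hz'
      simp only
      linarith
    linarith
  have key : ∀ z ∈ S, ∀ z' ∈ S, |inner ℝ z u - inner ℝ z' u| ≤ D / 2 → dist z z' ≤ D' := by
    intro z hz z' hz' h
    obtain ⟨τ, hτ⟩ := hS z hz
    obtain ⟨τ', hτ'⟩ := hS z' hz'
    have hperp : ∀ v : E, ‖v - inner ℝ v u • u‖ ^ 2 = ‖v‖ ^ 2 - (inner ℝ v u) ^ 2 := by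
      intro v
      rw [norm_sub_sq_real, inner_smul_right, norm_smul, hu, Real.norm_eq_abs, mul_one, sq_abs]
      ring
    have hperp_le : ∀ v : E, ‖v - inner ℝ v u • u‖ ≤ ‖v‖ := by
      intro v
      refine abs_le_of_sq_le_sq' ?_ (norm_nonneg _) |>.2
      rw [hperp]
      nlinarith [sq_nonneg (inner ℝ v u)]
    have huu : inner ℝ u u = (1 : ℝ) := by rw [real_inner_self_eq_norm_sq, hu]; norm_num
    have hsplit : (z - z') - inner ℝ (z - z') u • u =
        ((z - (p + τ • u)) - inner ℝ (z - (p + τ • u)) u • u) -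
        ((z' - (p + τ' • u)) - inner ℝ (z' - (p + τ' • u)) u • u) := by
      simp only [inner_sub_left, inner_add_left, real_inner_smul_left, huu]
      module
    have hle : ‖(z - z') - inner ℝ (z - z') u • u‖ ≤ 2 * w := by
      rw [hsplit]
      refine (norm_sub_le _ _).trans ?_
      have h1 := (hperp_le (z - (p + τ • u))).trans_eq (dist_eq_norm _ _).symm
      have h2 := (hperp_le (z' - (p + τ' • u))).trans_eq (dist_eq_norm _ _).symm
      linarith
    have hsq := hperp (z - z')
    have h1 : ‖(z - z') - inner ℝ (z - z') u • u‖ ^ 2 ≤ (2 * w) ^ 2 :=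
      pow_le_pow_left₀ (norm_nonneg _) hle 2
    have h2 : (inner ℝ (z - z') u) ^ 2 ≤ (D / 2) ^ 2 := by
      rw [inner_sub_left, ← sq_abs]
      exact pow_le_pow_left₀ (abs_nonneg _) h 2
    rw [dist_eq_norm]
    exact (abs_le_of_sq_le_sq' (by linarith) hD').2
  refine ⟨![{z ∈ S | inner ℝ z u ≤ a + D / 2}, {z ∈ S | a + D / 2 < inner ℝ z u}], ?_, ?_, ?_⟩
  · intro i
    fin_cases i
    · exact fun z hz => hz.1
    · exact fun z hz => hz.1
  · intro z hz
    rw [Set.mem_iUnion]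
    rcases le_or_gt (inner ℝ z u) (a + D / 2) with h | h
    · exact ⟨0, hz, h⟩
    · exact ⟨1, hz, h⟩
  · intro i
    fin_cases i
    · rintro z ⟨hz, h⟩ z' ⟨hz', h'⟩
      refine key z hz z' hz' (abs_le.2 ⟨?_, ?_⟩) <;> linarith [hlo z hz, hlo z' hz']
    · rintro z ⟨hz, h⟩ z' ⟨hz', h'⟩
      refine key z hz z' hz' (abs_le.2 ⟨?_, ?_⟩) <;> linarith [hhi z hz, hhi z' hz']

/-- In a finite-dimensional space there is a number `M` such that every set of diameter at most `D`
is the union of `M` sets with diameter at most `D / 2`. -/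
theorem exists_card_pieces (E : Type*) [NormedAddCommGroup E] [NormedSpace ℝ E]
    [FiniteDimensional ℝ E] :
    ∃ M : ℕ, 2 ≤ M ∧ ∀ (S : Set E) (D : ℝ), 0 < D → (∀ z ∈ S, ∀ z' ∈ S, dist z z' ≤ D) →
      ∃ P : Fin M → Set E, (∀ i, P i ⊆ S) ∧ S ⊆ ⋃ i, P i ∧
        ∀ i, ∀ z ∈ P i, ∀ z' ∈ P i, dist z z' ≤ D / 2 := by
  have : ProperSpace E := FiniteDimensional.proper ℝ E
  obtain ⟨t, -, htf, ht⟩ := Metric.finite_approx_of_totallyBounded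
    (isCompact_closedBall (0 : E) 1).totallyBounded (1 / 4) (by norm_num)
  have := htf.to_subtype
  obtain ⟨n, ⟨e⟩⟩ := Finite.exists_equiv_fin t
  -- The two surplus indices give empty pieces and ensure `2 ≤ M`.
  refine ⟨n + 2, by omega, fun S D hD hS => ?_⟩
  rcases S.eq_empty_or_nonempty with rfl | ⟨x, hx⟩
  · exact ⟨fun _ => ∅, by simp, by simp, by simp⟩
  refine ⟨fun i => {z ∈ S | ∃ h : (i : ℕ) < n, dist (D⁻¹ • (z - x)) (e.symm ⟨i, h⟩ : E) < 1 / 4},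
    fun i z hz => hz.1, ?_, ?_⟩
  · intro z hz
    have hmem : D⁻¹ • (z - x) ∈ Metric.closedBall (0 : E) 1 := by
      rw [mem_closedBall_zero_iff, norm_smul, norm_inv, Real.norm_of_nonneg hD.le,
        ← dist_eq_norm, inv_mul_le_iff₀ hD, mul_one]
      exact hS z hz x hx
    obtain ⟨y, hy, hzy⟩ := Set.mem_iUnion₂.1 (ht hmem)
    refine Set.mem_iUnion.2 ⟨⟨e ⟨y, hy⟩, by omega⟩, hz, (e ⟨y, hy⟩).2, ?_⟩
    simpa using hzy
  · rintro i z ⟨-, h, hz⟩ z' ⟨-, h', hz'⟩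
    have h1 : dist (D⁻¹ • (z - x)) (D⁻¹ • (z' - x)) ≤ 1 / 2 := by
      have := dist_triangle_right (D⁻¹ • (z - x)) (D⁻¹ • (z' - x)) (e.symm ⟨i, h⟩ : E)
      linarith
    rw [dist_smul₀, dist_sub_right, norm_inv, Real.norm_of_nonneg hD.le,
      inv_mul_le_iff₀ hD] at h1
    linarith

/-! ### Weighted covers and Hausdorff dimension -/

/-- The counting tree: if sets with a good point split into two pieces and all others into `M`,
then the `T`-th generation carries weights of total mass at most one. -/
theorem exists_weighted_cover {E : Type*} [PseudoMetricSpace E] {K : Set E} {D : ℕ → ℝ}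
    {bad : ℕ → E → Prop} [∀ k x, Decidable (bad k x)] {M : ℕ} (hM : 2 ≤ M)
    (h0 : ∀ x ∈ K, ∀ y ∈ K, dist x y ≤ D 0)
    (hgood : ∀ k, ∀ S ⊆ K, (∀ z ∈ S, ∀ z' ∈ S, dist z z' ≤ D k) → (∃ x ∈ S, ¬ bad k x) →
      ∃ P : Fin 2 → Set E, (∀ i, P i ⊆ S) ∧ S ⊆ ⋃ i, P i ∧
        ∀ i, ∀ z ∈ P i, ∀ z' ∈ P i, dist z z' ≤ D (k + 1))
    (hbad : ∀ k, ∀ S ⊆ K, (∀ z ∈ S, ∀ z' ∈ S, dist z z' ≤ D k) →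
      ∃ P : Fin M → Set E, (∀ i, P i ⊆ S) ∧ S ⊆ ⋃ i, P i ∧
        ∀ i, ∀ z ∈ P i, ∀ z' ∈ P i, dist z z' ≤ D (k + 1)) (T : ℕ) :
    ∃ (ι : Type) (_ : Fintype ι) (S : ι → Set E) (b : ι → ℕ), (∀ i, S i ⊆ K) ∧
      (∀ i, ∀ z ∈ S i, ∀ z' ∈ S i, dist z z' ≤ D T) ∧
      (∀ x ∈ K, ∃ i, x ∈ S i ∧ b i ≤ ((Finset.range T).filter (bad · x)).card) ∧
      ∑ i, (1 / 2 : ℝ) ^ T * (2 / M : ℝ) ^ b i ≤ 1 := by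
  have hM0 : (0 : ℝ) < M := by exact_mod_cast (by omega : 0 < M)
  induction T with
  | zero => exact ⟨Unit, inferInstance, fun _ => K, fun _ => 0, by simp, by simpa using h0,
      by simp, by simp⟩
  | succ T ih =>
    obtain ⟨ι, _, S, b, hSK, hSD, hcov, hsum⟩ := ih
    have hstep : ∀ i, ∃ (n e : ℕ) (P : Fin n → Set E), (∀ j, P j ⊆ S i) ∧ S i ⊆ ⋃ j, P j ∧
        (∀ j, ∀ z ∈ P j, ∀ z' ∈ P j, dist z z' ≤ D (T + 1)) ∧
        (n : ℝ) * ((1 / 2) * (2 / M) ^ e) = 1 ∧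
        ∀ x ∈ S i, e ≤ if bad T x then 1 else 0 := by
      intro i
      -- One good point suffices for the cheap split, so `b` grows only when the generation is bad
      -- for every point of the set.
      by_cases h : ∃ x ∈ S i, ¬ bad T x
      · obtain ⟨P, h1, h2, h3⟩ := hgood T (S i) (hSK i) (hSD i) h
        exact ⟨2, 0, P, h1, h2, h3, by norm_num, fun _ _ => Nat.zero_le _⟩
      · push Not at h
        obtain ⟨P, h1, h2, h3⟩ := hbad T (S i) (hSK i) (hSD i)
        refine ⟨M, 1, P, h1, h2, h3, by field_simp, fun x hx => by simp [h x hx]⟩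
    choose n e P hPS hSP hPD hne he using hstep
    refine ⟨Σ i, Fin (n i), inferInstance, fun j => P j.1 j.2, fun j => b j.1 + e j.1,
      fun j => (hPS _ _).trans (hSK _), fun j => hPD _ _, ?_, ?_⟩
    · intro x hx
      obtain ⟨i, hi, hbi⟩ := hcov x hx
      obtain ⟨j, hj⟩ := Set.mem_iUnion.1 (hSP i hi)
      refine ⟨⟨i, j⟩, hj, ?_⟩
      have := he i x hi
      rw [Finset.range_add_one, Finset.filter_insert]
      split_ifs at this ⊢ with hb
      · rw [Finset.card_insert_of_notMem (by simp)]
        simp only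
        omega
      · simp only
        omega
    · rw [Fintype.sum_sigma]
      refine le_trans (le_of_eq (Finset.sum_congr rfl fun i _ => ?_)) hsum
      simp only [Finset.sum_const, Finset.card_univ, Fintype.card_fin, nsmul_eq_mul, pow_succ,
        pow_add]
      linear_combination ((1 / 2 : ℝ) ^ T * (2 / M : ℝ) ^ b i) * hne i

/-- If every point of `K` lies, for infinitely many `T`, in a low-multiplicity member of the `T`-th
weighted cover, then the dimension of `K` is bounded by the exponent that makes the weighted sums
converge. -/
theorem dimH_le_of_weighted_cover {E : Type*} [MetricSpace E] {K : Set E} {s η : ℝ}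
    {α : NNReal} {M : ℕ} {cnt : ℕ → E → ℕ} (hs0 : 0 < s) (hs1 : s < 1) (hM : 2 ≤ M)
    (hq : s ^ (α : ℝ) * 2 * (M / 2 : ℝ) ^ η < 1)
    (hcover : ∀ T : ℕ, ∃ (ι : Type) (_ : Fintype ι) (S : ι → Set E) (b : ι → ℕ),
      (∀ i, ∀ z ∈ S i, ∀ z' ∈ S i, dist z z' ≤ s ^ T) ∧
      (∀ x ∈ K, ∃ i, x ∈ S i ∧ b i ≤ cnt T x) ∧
      ∑ i, (1 / 2 : ℝ) ^ T * (2 / M : ℝ) ^ b i ≤ 1)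
    (hK : ∀ x ∈ K, ∃ᶠ T : ℕ in atTop, (cnt T x : ℝ) ≤ 1 + η * T) :
    dimH K ≤ α := by
  borelize E
  choose ι hι S b hS hcov hsum using hcover
  have hM0 : (2 : ℝ) ≤ M := by exact_mod_cast hM
  have hM1 : (1 : ℝ) ≤ M / 2 := by linarith
  obtain ⟨q, hqdef⟩ : ∃ q, q = s ^ (α : ℝ) * 2 * (M / 2 : ℝ) ^ η := ⟨_, rfl⟩
  have hq0 : 0 ≤ q := by rw [hqdef]; positivity
  rw [← hqdef] at hq
  let G : ∀ T, Finset (ι T) := fun T => Finset.univ.filter fun i => (b T i : ℝ) ≤ 1 + η * T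
  have hcard : ∀ T, ((G T).card : ℝ) * (s ^ T) ^ (α : ℝ) ≤ M / 2 * q ^ T := by
    intro T
    have h1 : ((G T).card : ℝ) * ((1 / 2) ^ T * ((M / 2 : ℝ) ^ (1 + η * T))⁻¹) ≤ 1 := by
      refine le_trans ?_ (hsum T)
      rw [← nsmul_eq_mul, ← Finset.sum_const]
      refine (Finset.sum_le_sum fun i hi => ?_).trans
        (Finset.sum_le_sum_of_subset_of_nonneg (Finset.subset_univ (G T)) fun i _ _ => by positivity)
      have hi' : (b T i : ℝ) ≤ 1 + η * T := (Finset.mem_filter.1 hi).2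
      rw [← inv_div (M : ℝ) 2, inv_pow]
      gcongr
      rw [← Real.rpow_natCast]
      exact Real.rpow_le_rpow_of_exponent_le hM1 hi'
    have hpos : (0 : ℝ) < M / 2 := by linarith
    have hP : 0 < (M / 2 : ℝ) ^ (1 + η * T) := by positivity
    have h2 : ((G T).card : ℝ) ≤ 2 ^ T * (M / 2 : ℝ) ^ (1 + η * T) := by
      have : ((G T).card : ℝ) * ((1 / 2) ^ T * ((M / 2 : ℝ) ^ (1 + η * T))⁻¹) =
          (G T).card / (2 ^ T * (M / 2 : ℝ) ^ (1 + η * T)) := by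
        rw [one_div, inv_pow, ← mul_inv, ← div_eq_mul_inv]
      rwa [this, div_le_one (by positivity)] at h1
    calc ((G T).card : ℝ) * (s ^ T) ^ (α : ℝ)
        ≤ (2 ^ T * (M / 2 : ℝ) ^ (1 + η * T)) * (s ^ T) ^ (α : ℝ) := by gcongr
      _ = M / 2 * q ^ T := by
        rw [hqdef, Real.rpow_add hpos, Real.rpow_one, Real.rpow_mul hpos.le, Real.rpow_natCast,
          ← Real.rpow_natCast s T, ← Real.rpow_mul hs0.le, mul_comm (T : ℝ),
          Real.rpow_mul hs0.le, Real.rpow_natCast]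
        ring
  have hsummable : Summable fun T : ℕ => (M / 2 : ℝ) * q ^ T :=
    (summable_geometric_of_lt_one hq0 hq).mul_left _
  refine dimH_le_of_hausdorffMeasure_ne_top (ne_top_of_le_ne_top
    (ENNReal.ofReal_ne_top (r := ∑' T : ℕ, (M / 2 : ℝ) * q ^ T)) ?_)
  -- Each point is caught for infinitely many generations only, so the cover uses the light sets of
  -- all generations from `T₀` on.
  refine (Measure.hausdorffMeasure_le_liminf_tsum (l := atTop) (α : ℝ) K
    (ι := fun T₀ : ℕ => Σ T : ℕ, G (T₀ + T)) (fun T₀ => ENNReal.ofReal (s ^ T₀)) ?_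
    (fun T₀ j => S (T₀ + j.1) j.2) ?_ ?_).trans ?_
  · rw [← ENNReal.ofReal_zero]
    exact ENNReal.tendsto_ofReal (tendsto_pow_atTop_nhds_zero_of_lt_one hs0.le hs1)
  · refine Eventually.of_forall fun T₀ j => Metric.ediam_le fun z hz z' hz' => ?_
    rw [edist_dist]
    exact ENNReal.ofReal_le_ofReal ((hS _ _ z hz z' hz').trans
      (pow_le_pow_of_le_one hs0.le hs1.le (Nat.le_add_right _ _)))
  · refine Eventually.of_forall fun T₀ x hx => ?_
    obtain ⟨T, hT, hxT⟩ := frequently_atTop.1 (hK x hx) T₀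
    obtain ⟨i, hxi, hbi⟩ := hcov T x hx
    obtain ⟨k, rfl⟩ := Nat.exists_eq_add_of_le hT
    refine Set.mem_iUnion.2 ⟨⟨k, i, ?_⟩, hxi⟩
    refine Finset.mem_filter.2 ⟨Finset.mem_univ _, le_trans ?_ hxT⟩
    exact_mod_cast hbi
  · refine liminf_le_of_le (by isBoundedDefault) fun c hc => ?_
    obtain ⟨T₀, hT₀⟩ := hc.exists
    refine hT₀.trans ?_
    rw [ENNReal.tsum_sigma', ENNReal.ofReal_tsum_of_nonneg (fun T => by positivity) hsummable]
    refine ENNReal.tsum_le_tsum fun T => ?_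
    calc ∑' i : G (T₀ + T), Metric.ediam (S (T₀ + T) i) ^ (α : ℝ)
        ≤ ∑' _ : G (T₀ + T), ENNReal.ofReal ((s ^ (T₀ + T)) ^ (α : ℝ)) := by
          refine ENNReal.tsum_le_tsum fun i => ?_
          rw [← ENNReal.ofReal_rpow_of_nonneg (by positivity) α.coe_nonneg]
          refine ENNReal.rpow_le_rpow (Metric.ediam_le fun z hz z' hz' => ?_) α.coe_nonneg
          rw [edist_dist]
          exact ENNReal.ofReal_le_ofReal (hS _ _ z hz z' hz')
      _ = ENNReal.ofReal ((G (T₀ + T)).card * (s ^ (T₀ + T)) ^ (α : ℝ)) := by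
          rw [tsum_fintype, Finset.sum_const, Finset.card_univ, Fintype.card_coe, nsmul_eq_mul,
            ENNReal.ofReal_mul (by positivity), ENNReal.ofReal_natCast]
      _ ≤ ENNReal.ofReal (M / 2 * q ^ T) := by
          refine ENNReal.ofReal_le_ofReal ((hcard _).trans ?_)
          exact mul_le_mul_of_nonneg_left
            (pow_le_pow_of_le_one hq0 hq.le (Nat.le_add_left _ _)) (by linarith)

/-! ### Flat scales against bad generations -/

/-- If the intervals `[t (k - 1), t k)`, `k ∈ B`, and `[a m, a (m + 1))`, `m ∈ G`, lie in `[0, a N)`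
and no interval of the first kind meets one of the second, then their total length is at most
`a N`. -/
theorem mul_card_add_mul_card_le {t a : ℝ} (ht : 0 < t) (ha : 0 < a) {N : ℕ} {B G : Finset ℕ}
    (hG : ∀ m ∈ G, m < N) (hB : ∀ k ∈ B, 1 ≤ k ∧ t * k ≤ a * N)
    (hBG : ∀ k ∈ B, ∀ m ∈ G, a * m < t * k → a * (m + 1) ≤ t * (k - 1)) :
    t * B.card + a * G.card ≤ a * N := by
  have hmono : ∀ c : ℝ, 0 < c → ∀ r : ℝ, ∀ i j : ℕ, i ≠ j →
      Disjoint (Set.Ico (c * (i + r)) (c * (i + r + 1))) (Set.Ico (c * (j + r)) (c * (j + r + 1))) := by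
    intro c hc r i j hij
    rw [Set.disjoint_left]
    rintro y ⟨h1, h2⟩ ⟨h3, h4⟩
    have h5 := lt_of_mul_lt_mul_left (h1.trans_lt h4) hc.le
    have h6 := lt_of_mul_lt_mul_left (h3.trans_lt h2) hc.le
    have h7 : i < j + 1 := by exact_mod_cast (by linarith : (i : ℝ) < j + 1)
    have h8 : j < i + 1 := by exact_mod_cast (by linarith : (j : ℝ) < i + 1)
    omega
  let U : Set ℝ := ⋃ k ∈ B, Set.Ico (t * ((k : ℝ) + (-1))) (t * (k + (-1) + 1))
  let V : Set ℝ := ⋃ m ∈ G, Set.Ico (a * ((m : ℝ) + 0)) (a * (m + 0 + 1))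
  have hvol : ∀ c : ℝ, 0 < c → ∀ r : ℝ, ∀ A : Finset ℕ,
      volume (⋃ k ∈ A, Set.Ico (c * ((k : ℝ) + r)) (c * (k + r + 1))) =
        ENNReal.ofReal (c * A.card) := by
    intro c hc r A
    rw [measure_biUnion_finset (fun i _ j _ hij => hmono c hc r i j hij)
      fun _ _ => measurableSet_Ico]
    simp only [Real.volume_Ico]
    rw [← ENNReal.ofReal_sum_of_nonneg (fun _ _ => by nlinarith)]
    congr 1
    simp only [mul_add, mul_one, add_sub_cancel_left, Finset.sum_const, nsmul_eq_mul]
    ring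
  have hUV : Disjoint U V := by
    rw [Set.disjoint_left]
    intro y hU hV
    obtain ⟨k, hk, h1, h2⟩ := Set.mem_iUnion₂.1 hU
    obtain ⟨m, hm, h3, h4⟩ := Set.mem_iUnion₂.1 hV
    rw [add_zero] at h3 h4
    rw [neg_add_cancel_right] at h2
    have := hBG k hk m hm (h3.trans_lt h2)
    rw [sub_eq_add_neg] at this
    linarith
  have hVm : MeasurableSet V := Finset.measurableSet_biUnion _ fun _ _ => measurableSet_Ico
  have hsub : U ∪ V ⊆ Set.Ico 0 (a * N) := by
    refine Set.union_subset (Set.iUnion₂_subset fun k hk y hy => ?_)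
      (Set.iUnion₂_subset fun m hm y hy => ?_)
    · obtain ⟨hk1, hk2⟩ := hB k hk
      have hk1' : (1 : ℝ) ≤ k := by exact_mod_cast hk1
      have h1 := hy.1
      have h2 := hy.2
      rw [neg_add_cancel_right] at h2
      exact ⟨le_trans (mul_nonneg ht.le (by linarith)) h1, h2.trans_le hk2⟩
    · have hm' : (m : ℝ) + 1 ≤ N := by exact_mod_cast hG m hm
      have h1 := hy.1
      have h2 := hy.2
      rw [add_zero] at h1 h2
      exact ⟨le_trans (by positivity) h1, h2.trans_le (mul_le_mul_of_nonneg_left hm' ha.le)⟩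
  have := measure_mono (μ := volume) hsub
  rw [measure_union hUV hVm, hvol t ht, hvol a ha, Real.volume_Ico, sub_zero,
    ← ENNReal.ofReal_add (by positivity) (by positivity)] at this
  exact (ENNReal.ofReal_le_ofReal_iff (by positivity)).1 this

/-- A scale with beta number at most `β > 0` has a line approximating the set up to `2 β r`. -/
theorem exists_strip_of_betaNumber_le {d : ℕ} {K : Set (EuclideanSpace ℝ (Fin d))}
    {x : EuclideanSpace ℝ (Fin d)} {r β : ℝ} (hr : 0 < r) (hβ : 0 < β)
    (h : betaNumber K x r ≤ ENNReal.ofReal β) :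
    ∃ p u : EuclideanSpace ℝ (Fin d), ‖u‖ = 1 ∧
      ∀ z ∈ K ∩ Metric.ball x r, ∃ τ : ℝ, dist z (p + τ • u) ≤ 2 * β * r := by
  -- The infimum over lines need not be attained; doubling `β` leaves room to pick a line.
  have hlt : betaNumber K x r < ENNReal.ofReal (2 * β) :=
    h.trans_lt ((ENNReal.ofReal_lt_ofReal_iff (by linarith)).2 (by linarith))
  obtain ⟨⟨L, hL⟩, hsup⟩ := iInf_lt_iff.1 hlt
  have hLne : (L : Set (EuclideanSpace ℝ (Fin d))).Nonempty := by
    rw [AffineSubspace.nonempty_iff_ne_bot]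
    rintro rfl
    have h0 : Module.finrank ℝ
        (⊥ : AffineSubspace ℝ (EuclideanSpace ℝ (Fin d))).direction = 1 := hL
    rw [AffineSubspace.direction_bot, finrank_bot] at h0
    exact zero_ne_one h0
  obtain ⟨v, hv0, hv⟩ := finrank_eq_one_iff'.1 hL
  have hv0' : (v : EuclideanSpace ℝ (Fin d)) ≠ 0 := by simpa using hv0
  obtain ⟨p, hp⟩ := hLne
  refine ⟨p, (‖(v : EuclideanSpace ℝ (Fin d))‖⁻¹ : ℝ) • (v : EuclideanSpace ℝ (Fin d)),
    norm_smul_inv_norm hv0', fun z hz => ?_⟩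
  have h1 : Metric.infEDist z (L : Set (EuclideanSpace ℝ (Fin d))) / ENNReal.ofReal r <
      ENNReal.ofReal (2 * β) := (le_iSup₂ (f := fun z _ => Metric.infEDist z
        (L : Set (EuclideanSpace ℝ (Fin d))) / ENNReal.ofReal r) z hz).trans_lt hsup
  rw [ENNReal.div_lt_iff (Or.inl (ENNReal.ofReal_pos.2 hr).ne') (Or.inl ENNReal.ofReal_ne_top),
    ← ENNReal.ofReal_mul (by linarith), Metric.infEDist_lt_iff] at h1
  obtain ⟨y, hy, hzy⟩ := h1
  rw [edist_dist, ENNReal.ofReal_lt_ofReal_iff (by positivity)] at hzy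
  obtain ⟨c, hc⟩ := hv ⟨y -ᵥ p, AffineSubspace.vsub_mem_direction hy hp⟩
  have hc' : c • (v : EuclideanSpace ℝ (Fin d)) = y - p := congrArg Subtype.val hc
  refine ⟨c * ‖(v : EuclideanSpace ℝ (Fin d))‖, ?_⟩
  rw [smul_smul, mul_assoc, mul_inv_cancel₀ (norm_ne_zero_iff.2 hv0'), mul_one, hc',
    add_sub_cancel]
  exact hzy.le

/-- At a point of almost flatness, infinitely often all but a fraction `1 - kap` of the first `T`
scales `s ^ k` are comparable to a flat scale `lam ^ m`. -/
theorem frequently_card_le_of_almostFlatAt {d : ℕ} {K : Set (EuclideanSpace ℝ (Fin d))}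
    {x : EuclideanSpace ℝ (Fin d)} {lam kap beta0 s : ℝ} {bad : ℕ → Prop} [DecidablePred bad]
    (hlam : lam ∈ Set.Ioo (0 : ℝ) 1) (hkap : kap ≤ 1) (hs : 1 / 2 ≤ s) (hs1 : s < 1)
    (hbad : ∀ k, bad k → ∀ m : ℕ, betaNumber K x (lam ^ m) ≤ ENNReal.ofReal beta0 →
      s ^ k < lam ^ m → 2 / lam * s ^ k < lam ^ m)
    (h : AlmostFlatAt K x lam kap beta0) :
    ∃ᶠ T : ℕ in atTop, (((Finset.range T).filter bad).card : ℝ) ≤ 1 + (1 - kap) * T := by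
  obtain ⟨N, -, hNtop, hN⟩ := h
  obtain ⟨hlam0, hlam1⟩ := hlam
  have hs0 : 0 < s := by linarith
  obtain ⟨a, ha⟩ : ∃ a, a = -Real.log lam := ⟨_, rfl⟩
  obtain ⟨t, ht⟩ : ∃ t, t = -Real.log s := ⟨_, rfl⟩
  have ha0 : 0 < a := by rw [ha]; linarith [Real.log_neg hlam0 hlam1]
  have ht0 : 0 < t := by rw [ht]; linarith [Real.log_neg hs0 hs1]
  have ht2 : t ≤ Real.log 2 := by
    rw [ht, ← Real.log_inv]
    exact Real.log_le_log (by positivity) (by rw [inv_le_comm₀ hs0 (by norm_num)]; linarith)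
  rw [frequently_atTop]
  intro n
  obtain ⟨i, hi⟩ := (hNtop.eventually_ge_atTop ⌈n * t / a⌉₊).exists
  have hi' : (n : ℝ) * t / a ≤ N i := (Nat.le_ceil _).trans (by exact_mod_cast hi)
  have hlt : a * N i / t < ⌊a * N i / t⌋₊ + 1 := Nat.lt_floor_add_one _
  -- With this `T`, `k < T` means `t * k ≤ a * N i`: the generations down to scale `lam ^ N i`.
  refine ⟨⌊a * N i / t⌋₊ + 1, ?_, ?_⟩
  · have h1 : (n : ℝ) ≤ a * N i / t := by
      rw [le_div_iff₀ ht0]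
      rw [div_le_iff₀ ha0] at hi'
      linarith
    exact_mod_cast (h1.trans hlt.le)
  generalize hT : ⌊a * N i / t⌋₊ + 1 = T
  have hTr : a * N i / t < T := by rw [← hT]; exact_mod_cast hlt
  classical
  let G : Finset ℕ := (Finset.range (N i)).filter fun m =>
    betaNumber K x (lam ^ m) ≤ ENNReal.ofReal beta0
  -- Generation `0` is left out, as its interval `[-t, 0)` sticks out of `[0, a * N i)`; it accounts
  -- for the `1` in the bound.
  let B : Finset ℕ := (Finset.Ico 1 T).filter bad
  have hGcard : kap * (N i : ℝ) < G.card := by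
    have := hN i
    rwa [show {m : ℕ | m < N i ∧ betaNumber K x (lam ^ m) ≤ ENNReal.ofReal beta0} = (G : Set ℕ) by
      ext m; simp [G], Set.ncard_coe_finset] at this
  have hmain : t * B.card + a * G.card ≤ a * N i := by
    refine mul_card_add_mul_card_le ht0 ha0 (fun m hm => ?_) (fun k hk => ?_) ?_
    · exact Finset.mem_range.1 (Finset.mem_filter.1 hm).1
    · obtain ⟨hk1, hk2⟩ := Finset.mem_Ico.1 (Finset.mem_filter.1 hk).1
      refine ⟨hk1, ?_⟩
      have h1 : (k : ℝ) ≤ a * N i / t :=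
        (Nat.cast_le.2 (show k ≤ ⌊a * N i / t⌋₊ by omega)).trans (Nat.floor_le (by positivity))
      rw [le_div_iff₀ ht0] at h1
      linarith
    -- Badness gives `a * (m + 1) + log 2 < t * k`; since `t ≤ log 2`, the factor `2` in `2 / lam`
    -- pays for the length `t` of the interval of `k`.
    · intro k hk m hm hlt
      have hlogs : Real.log (s ^ k) = -(t * k) := by rw [Real.log_pow, ht]; ring
      have hlogl : Real.log (lam ^ m) = -(a * m) := by rw [Real.log_pow, ha]; ring
      have h1 : s ^ k < lam ^ m := by
        rw [← Real.log_lt_log_iff (by positivity) (by positivity), hlogs, hlogl]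
        linarith
      have h2 := hbad k (Finset.mem_filter.1 hk).2 m (Finset.mem_filter.1 hm).2 h1
      rw [← Real.log_lt_log_iff (by positivity) (by positivity),
        Real.log_mul (by positivity) (by positivity), Real.log_div (by norm_num) hlam0.ne', hlogs,
        hlogl] at h2
      linarith
  have hBcard : (B.card : ℝ) ≤ (1 - kap) * T := by
    have h1 : t * B.card ≤ (1 - kap) * (a * N i) := by nlinarith
    have h2 : a * N i ≤ T * t := ((div_lt_iff₀ ht0).1 hTr).le
    have h3 := mul_le_mul_of_nonneg_left h2 (sub_nonneg.2 hkap)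
    exact le_of_mul_le_mul_left (by linarith) ht0
  have hcard : ((Finset.range T).filter bad).card ≤ 1 + B.card := by
    have : (Finset.range T).filter bad ⊆ insert 0 B := by
      intro k hk
      obtain ⟨hk1, hk2⟩ := Finset.mem_filter.1 hk
      rw [Finset.mem_range] at hk1
      rw [Finset.mem_insert, Finset.mem_filter, Finset.mem_Ico]
      rcases Nat.eq_zero_or_pos k with h0 | h0
      · exact Or.inl h0
      · exact Or.inr ⟨⟨h0, hk1⟩, hk2⟩
    have := (Finset.card_le_card this).trans (Finset.card_insert_le _ _)
    omega
  have : (((Finset.range T).filter bad).card : ℝ) ≤ 1 + B.card := by exact_mod_cast hcard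
  linarith

/-! ### The dimension bound and the constants -/

/-- The dimension bound in terms of the contraction ratio of the binary splitting. -/
theorem dimH_le_of_almostFlat {d M : ℕ} (hM : 2 ≤ M)
    (hpieces : ∀ (S : Set (EuclideanSpace ℝ (Fin d))) (D : ℝ), 0 < D →
      (∀ z ∈ S, ∀ z' ∈ S, dist z z' ≤ D) →
      ∃ P : Fin M → Set (EuclideanSpace ℝ (Fin d)), (∀ i, P i ⊆ S) ∧ S ⊆ ⋃ i, P i ∧
        ∀ i, ∀ z ∈ P i, ∀ z' ∈ P i, dist z z' ≤ D / 2)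
    {lam kap beta0 s : ℝ} (hlam : lam ∈ Set.Ioo (0 : ℝ) 1) (hkap : kap ≤ 1) (hbeta0 : 0 < beta0)
    (hs0 : 0 < s) (hs1 : s < 1) (hs : s ^ 2 = 1 / 4 + 64 * (beta0 / lam) ^ 2)
    {K : Set (EuclideanSpace ℝ (Fin d))} (hK : Metric.diam K = 1)
    (hflat : ∀ x ∈ K, AlmostFlatAt K x lam kap beta0) {α : NNReal}
    (hq : s ^ (α : ℝ) * 2 * (M / 2 : ℝ) ^ (1 - kap) < 1) : dimH K ≤ α := by
  classical
  have hs2 : 1 / 2 ≤ s := by nlinarith [sq_nonneg (beta0 / lam)]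
  -- `Metric.diam` is `0` on unbounded sets, so diameter `1` forces boundedness.
  have hbdd : Bornology.IsBounded K := by
    by_contra h
    rw [Metric.diam_eq_zero_of_unbounded h] at hK
    norm_num at hK
  have hlam0 : 0 < lam := hlam.1
  let bad : ℕ → EuclideanSpace ℝ (Fin d) → Prop := fun k x =>
    ∀ m : ℕ, betaNumber K x (lam ^ m) ≤ ENNReal.ofReal beta0 →
      s ^ k < lam ^ m → 2 / lam * s ^ k < lam ^ m
  refine dimH_le_of_weighted_cover hs0 hs1 hM hq (fun T => ?_)
    (cnt := fun T x => ((Finset.range T).filter (bad · x)).card)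
    (fun x hx => frequently_card_le_of_almostFlatAt hlam hkap hs2 hs1 (fun _ h => h) (hflat x hx))
  refine (exists_weighted_cover (K := K) (D := fun k => s ^ k) (bad := bad) hM ?_ ?_ ?_ T).imp
    fun _ => Exists.imp fun _ => Exists.imp fun _ => Exists.imp fun _ h => h.2
  · intro x hx y hy
    rw [pow_zero, ← hK]
    exact Metric.dist_le_diam_of_mem hbdd hx hy
  · rintro k S hSK hSD ⟨x, hxS, hx⟩
    simp only [bad] at hx
    push Not at hx
    obtain ⟨m, hm, h1, h2⟩ := hx
    obtain ⟨p, u, hu, hstrip⟩ := exists_strip_of_betaNumber_le (pow_pos hlam0 m) hbeta0 hm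
    -- The strip `2 * beta0 * lam ^ m` is widened using `lam ^ m ≤ 2 / lam * s ^ k`; then `(2 * w) ^
    -- 2 = 64 * (beta0 / lam) ^ 2 * (s ^ k) ^ 2`, the term built into `s ^ 2`.
    refine exists_two_pieces_of_strip (p := p) (w := 2 * beta0 * (2 / lam * s ^ k)) hu
      (by positivity) (le_of_eq ?_) (fun z hz => ?_) hSD
    · rw [pow_succ s, mul_pow _ s, hs]
      ring
    · obtain ⟨τ, hτ⟩ := hstrip z ⟨hSK hz, (hSD z hz x hxS).trans_lt h1⟩
      exact ⟨τ, hτ.trans (by gcongr)⟩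
  · intro k S _ hSD
    obtain ⟨P, h1, h2, h3⟩ := hpieces S (s ^ k) (by positivity) hSD
    refine ⟨P, h1, h2, fun i z hz z' hz' => (h3 i z hz z' hz').trans ?_⟩
    have := mul_le_mul_of_nonneg_left hs2 (pow_pos hs0 k).le
    rw [pow_succ]
    linarith

theorem theorem4 (d : ℕ) (hd : 2 ≤ d) :
    ∃ c : ℝ, 0 < c ∧
      ∀ lam kap beta0 : ℝ, lam ∈ Set.Ioo (0 : ℝ) 1 → kap ∈ Set.Ioo (0 : ℝ) 1 →
        beta0 ∈ Set.Ioo (0 : ℝ) 1 →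
        ∀ K : Set (EuclideanSpace ℝ (Fin d)), Metric.diam K = 1 →
          (∀ x ∈ K, AlmostFlatAt K x lam kap beta0) →
            dimH K ≤ ENNReal.ofReal (1 + c * (lam⁻¹) ^ 4 * (1 - kap + beta0 ^ 2 * kap)) := by
  obtain ⟨M, hM, hpieces⟩ := exists_card_pieces (EuclideanSpace ℝ (Fin d))
  have hM2 : (1 : ℝ) ≤ M / 2 := by
    rw [le_div_iff₀ (by norm_num)]
    exact_mod_cast (by omega : 1 * 2 ≤ M)
  have hd0 : (2 : ℝ) ≤ d := by exact_mod_cast hd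
  obtain ⟨l, hl⟩ : ∃ l, l = Real.log (M / 2 : ℝ) := ⟨_, rfl⟩
  have hl0 : 0 ≤ l := hl ▸ Real.log_nonneg hM2
  -- To be beaten in `log q`: `256 * X` and `256 * c * X * X ≤ 256 * d * X` from `log s`, and `l *
  -- X` from bad generations. The `1` makes it strict; the `2` reflects `log 2 ≥ 1 / 2`.
  obtain ⟨c, hc⟩ : ∃ c : ℝ, c = 2 * (256 + 256 * d + l + 1) := ⟨_, rfl⟩
  have hc0 : 0 < c := by rw [hc]; linarith
  refine ⟨c, hc0, ?_⟩
  rintro lam kap beta0 hlam ⟨hkap0, hkap1⟩ ⟨hbeta0, -⟩ K hK hflat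
  obtain ⟨hlam0, hlam1⟩ := id hlam
  obtain ⟨X, hX⟩ : ∃ X, X = (lam⁻¹) ^ 4 * (1 - kap + beta0 ^ 2 * kap) := ⟨_, rfl⟩
  rw [mul_assoc, ← hX]
  have hinv : 1 ≤ lam⁻¹ := (one_le_inv₀ hlam0).2 hlam1.le
  have hbk : 0 ≤ beta0 ^ 2 * kap := by positivity
  have hηX : 1 - kap ≤ X := by
    rw [hX]
    nlinarith [one_le_pow₀ (n := 4) hinv]
  have hX0 : 0 < X := by linarith
  -- For `c * X ≥ d` the trivial bound `dimH K ≤ d` suffices; otherwise `X` is small, which yields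
  -- `s < 1`.
  rcases le_or_gt (d : ℝ) (c * X) with hbig | hsmall
  · calc dimH K ≤ dimH (Set.univ : Set (EuclideanSpace ℝ (Fin d))) := dimH_mono (Set.subset_univ _)
      _ = d := by rw [Real.dimH_univ_eq_finrank, finrank_euclideanSpace_fin]
      _ = ENNReal.ofReal d := (ENNReal.ofReal_natCast d).symm
      _ ≤ _ := ENNReal.ofReal_le_ofReal (by linarith)
  have hXs : X < 1 / 512 := by
    have h1 : 512 * (d : ℝ) ≤ c := by rw [hc]; linarith
    have h2 := (mul_le_mul_of_nonneg_right h1 hX0.le).trans_lt hsmall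
    nlinarith
  have hbX : (beta0 / lam) ^ 2 ≤ 2 * X := by
    -- Here `kap > 1 / 2`, because `1 - kap ≤ X < 1 / 512`.
    have h1 : beta0 ^ 2 ≤ 2 * (1 - kap + beta0 ^ 2 * kap) := by nlinarith [sq_nonneg beta0]
    have h2 : (lam⁻¹) ^ 2 ≤ (lam⁻¹) ^ 4 := pow_le_pow_right₀ hinv (by norm_num)
    calc (beta0 / lam) ^ 2 = (lam⁻¹) ^ 2 * beta0 ^ 2 := by field_simp
      _ ≤ (lam⁻¹) ^ 4 * (2 * (1 - kap + beta0 ^ 2 * kap)) := by gcongr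
      _ = 2 * X := by rw [hX]; ring
  obtain ⟨b, hb⟩ : ∃ b, b = (beta0 / lam) ^ 2 := ⟨_, rfl⟩
  have hb0 : 0 < b := by rw [hb]; positivity
  rw [← hb] at hbX
  obtain ⟨s, hs⟩ : ∃ s, s = Real.sqrt (1 / 4 + 64 * b) := ⟨_, rfl⟩
  have hs0 : 0 < s := by rw [hs]; positivity
  have hssq : s ^ 2 = 1 / 4 + 64 * b := by rw [hs]; exact Real.sq_sqrt (by positivity)
  have hs1 : s < 1 := by nlinarith
  have hlogs : Real.log s ≤ -Real.log 2 + 256 * X := by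
    have h1 : Real.log (s ^ 2) = 2 * Real.log s := by rw [Real.log_pow]; norm_num
    have h2 : Real.log (s ^ 2) = Real.log (1 + 256 * b) - 2 * Real.log 2 := by
      rw [hssq, show (1 / 4 + 64 * b : ℝ) = (1 + 256 * b) / 2 ^ 2 by ring,
        Real.log_div (by positivity) (by norm_num), Real.log_pow]
      norm_num
    have h3 := Real.log_le_sub_one_of_pos (show 0 < 1 + 256 * b by positivity)
    linarith
  have hα0 : 0 ≤ 1 + c * X := by positivity
  have hα : ENNReal.ofReal (1 + c * X) = ((1 + c * X).toNNReal : NNReal) := rfl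
  rw [hα]
  refine dimH_le_of_almostFlat hM hpieces hlam hkap1.le hbeta0 hs0 hs1 (hb ▸ hssq) hK hflat ?_
  rw [Real.coe_toNNReal _ hα0]
  have hpos : (0 : ℝ) < M / 2 := by linarith
  rw [← Real.log_neg_iff (by positivity), Real.log_mul (by positivity) (by positivity),
    Real.log_mul (by positivity) (by norm_num), Real.log_rpow hs0, Real.log_rpow hpos, ← hl]
  have h1 := mul_le_mul_of_nonneg_left hlogs hα0
  have h2 : (1 - kap) * l ≤ X * l := mul_le_mul_of_nonneg_right hηX hl0
  have h3 : c * X * X ≤ d * X := mul_le_mul_of_nonneg_right hsmall.le hX0.le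
  have h4 : c * X * (1 / 2) ≤ c * X * Real.log 2 :=
    mul_le_mul_of_nonneg_left (by linarith [Real.log_two_gt_d9]) (by positivity)
  have h5 : c * X * (1 / 2) = (256 + 256 * d + l + 1) * X := by rw [hc]; ring
  nlinarith
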